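/- \textbf{Setting.} Let $n\ge 2$ and let $X_1,\dots,X_n$ be random variables on a probability space $(\Omega,\mathcal F,\mathbb P)$ such that: (1) they are identically distributed and \emph{super-Pareto}, i.e. each has the law of $f(Y)$ for some non-strictly increasing, convex, non-constant $f:[1,\infty)\to\mathbb R$ and $Y$ with $\mathbb P(Y>y)=1/y$, $y\ge 1$; (2) they are \emph{weakly negatively associated}, i.e. $\mathbb P(\mathbf X_{-i}\in S\mid X_i\le x)\le \mathbb P(\mathbf X_{-i}\in S)$ for every $i$, every decreasing (Borel) set $S\subseteq\mathbb R^{n-1}$ and every $x$ with $\mathbb P(X_i\le x)>0$, where $\mathbf X_{-i}=(X_j)_{j\ne i}$. Let $X$ be a random variable with the common law of the $X_i$, and write $\mathbf X=(X_1,\dots,X_n)$. Let $\mathcal X$ be a law-invariant set of random variables on $\Omega$ (if $Y\in\mathcal X$ and $Z$ has the same law as $Y$, then $Z\in\mathcal X$) that contains $\mathbf w\cdot\mathbf X+b$ for all $\mathbf w\in\mathbb R_+^n$, $b\in\mathbb R$. Each agent $i\in[n]=\{1,\dots,n\}$ has an initial exposure $a_i>0$, with exposure vector $\mathbf a^i=a_i\mathbf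 e_i$ (so the initial loss is $a_iX_i$); a convex cost function $c_i:\mathbb R\to[0,\infty)$ with $c_i(0)=0$, whose right and left derivatives are denoted $c_{i+}'$, $c_{i-}'$; and a \emph{mildly monotone} risk measure $\rho_i:\mathcal X\to\mathbb R$, i.e. for $Y,Z\in\mathcal X$: $\rho_i(Y)\le\rho_i(Z)$ whenever $\mathbb P(Y>x)\le\mathbb P(Z>x)$ for all $x$, and $\rho_i(Y)<\rho_i(Z)$ whenever $\mathbb P(Y<Z)=1$. With $\|\mathbf w\|=\sum_j|w_j|$, an \emph{equilibrium} is a tuple $(\mathbf p,\mathbf w^1,\dots,\mathbf w^n)\in(\mathbb R_+^n)^{n+1}$ such that, for each $i$, $\mathbf w^i$ minimizes $$\mathbf w\mapsto \rho_i\big(\mathbf w\cdot\mathbf X-(\mathbf w-\mathbf a^i)\cdot\mathbf p\big)+c_i(\|\mathbf w\|-\|\mathbf a^i\|)$$ over $\mathbf w\in\mathbb R_+^n$, and $\sum_i\mathbf w^i=\sum_i\mathbf a^i$. Then $\mathbf p$ is called an \emph{equilibrium price}. A \emph{distortion risk measure} on $\mathcal X$ is a finite-valued functional of the form $$\rho(Y)=\int_{-\infty}^0\big(h(\mathbb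 P(Y>x))-1\big)\,dx+\int_0^\infty h(\mathbb P(Y>x))\,dx,\qquad Y\in\mathcal X,$$ with $h:[0,1]\to[0,1]$ non-decreasing, $h(0)=0$, $h(1)=1$. \textbf{Theorem.} (i) Suppose that the law of $X$ is continuous, i.e. $\mathbb P(X=x)=0$ for all $x\in\mathbb R$. Then every equilibrium $(\mathbf p,\mathbf w^1,\dots,\mathbf w^n)$ satisfies $\mathbf p=(p,\dots,p)$ for some $p\in\mathbb R_+$, and $(\mathbf w^1,\dots,\mathbf w^n)$ is a permutation of $(\mathbf a^1,\dots,\mathbf a^n)$. (ii) Suppose that $\rho_1,\dots,\rho_n$ are distortion risk measures on $\mathcal X$. If $p\in\mathbb R_+$ satisfies $$c_{i+}'(0)\ \ge\ p-\rho_i(X)\ \ge\ c_{i-}'(0)\qquad\text{for all } i\in[n],$$ then $((p,\dots,p),\mathbf a^1,\dots,\mathbf a^n)$ is an equilibrium. (iii) Suppose that the law of $X$ is continuous and that $\rho_1,\dots,\rho_n$ are distortion risk measures on $\mathcal X$. If $(p,\dots,p)$ is an equilibrium price, then $$\max_{j\in[n]}c_{i+}'(a_j-a_i)\ \ge\ p-\rho_i(X)\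 \ge\ \min_{j\in[n]}c_{i-}'(a_j-a_i)\qquad\text{for all } i\in[n].$$ -/

import Mathlib

open MeasureTheory ProbabilityTheory Set

noncomputable section

namespace RiskSharing

variable {Ω : Type*} [MeasurableSpace Ω]

/-- The random variable `X` is super-Pareto: it has the law of `f Y`, where `Y` has the
Pareto law with distribution function `1 - 1 / y` on `[1, ∞)` and `f` is a (non-strictly)
increasing, convex and non-constant function on `[1, ∞)`. -/
def IsSuperPareto (μ : Measure Ω) (X : Ω → ℝ) : Prop :=
  ∃ f : ℝ → ℝ, MonotoneOn f (Ici 1) ∧ ConvexOn ℝ (Ici 1) f ∧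
    (∃ x ∈ Ici (1 : ℝ), ∃ y ∈ Ici (1 : ℝ), f x ≠ f y) ∧
    μ.map X = (paretoMeasure 1 1).map f

/-- Weak negative association: conditioning on `X i ≤ x` does not increase the probability
that the vector of the other variables lies in a given decreasing (Borel) set. -/
def WeaklyNegativelyAssociated (μ : Measure Ω) {n : ℕ} (X : Fin n → Ω → ℝ) : Prop :=
  ∀ (i : Fin n) (S : Set ({j : Fin n // j ≠ i} → ℝ)), MeasurableSet S → IsLowerSet S →
    ∀ x : ℝ, 0 < μ {ω | X i ω ≤ x} →
      cond μ {ω | X i ω ≤ x} {ω | (fun j : {j : Fin n // j ≠ i} => X j ω) ∈ S} ≤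
        μ {ω | (fun j : {j : Fin n // j ≠ i} => X j ω) ∈ S}

/-- The random variables `X i` are weakly negatively associated and identically distributed
(WNAID) super-Pareto. -/
structure IsWNAIDSuperPareto (μ : Measure Ω) {n : ℕ} (X : Fin n → Ω → ℝ) : Prop where
  measurable : ∀ i, Measurable (X i)
  superPareto : ∀ i, IsSuperPareto μ (X i)
  identDistrib : ∀ i j, IdentDistrib (X i) (X j) μ μ
  weaklyNegativelyAssociated : WeaklyNegativelyAssociated μ X

/-- First-order stochastic dominance `X ≤_st Y`. -/
def StochLE (μ : Measure Ω) (X Y : Ω → ℝ) : Prop :=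
  ∀ x : ℝ, μ {ω | x < X ω} ≤ μ {ω | x < Y ω}

/-- The functional `ρ` is mildly monotone on the set `L` of losses: it is weakly monotone,
and it is strictly smaller at `X` than at `Y` when `X < Y` almost surely. Only the values of
`ρ` on `L` matter. -/
def MildlyMonotoneOn (μ : Measure Ω) (L : Set (Ω → ℝ)) (ρ : (Ω → ℝ) → ℝ) : Prop :=
  (∀ X ∈ L, ∀ Y ∈ L, StochLE μ X Y → ρ X ≤ ρ Y) ∧
  (∀ X ∈ L, ∀ Y ∈ L, (∀ᵐ ω ∂μ, X ω < Y ω) → ρ X < ρ Y)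

/-- The functional `ρ` is, on the set `L`, the (finite) distortion risk measure of some
distortion function `h`. -/
def IsDistortionOn (μ : Measure Ω) (L : Set (Ω → ℝ)) (ρ : (Ω → ℝ) → ℝ) : Prop :=
  ∃ h : ℝ → ℝ, MonotoneOn h (Icc 0 1) ∧ h 0 = 0 ∧ h 1 = 1 ∧
    ∀ Y ∈ L,
      IntegrableOn (fun x : ℝ => h (μ.real {ω | x < Y ω}) - 1) (Iic 0) ∧
      IntegrableOn (fun x : ℝ => h (μ.real {ω | x < Y ω})) (Ioi 0) ∧
      ρ Y = (∫ x in Iic (0 : ℝ), (h (μ.real {ω | x < Y ω}) - 1)) +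
        ∫ x in Ioi (0 : ℝ), h (μ.real {ω | x < Y ω})

/-- A domain of losses for the market with losses `X`: a law-invariant set of random variables
that contains the convex cone generated by the `X j` and the constants. -/
structure IsLossDomain (μ : Measure Ω) {n : ℕ} (X : Fin n → Ω → ℝ) (L : Set (Ω → ℝ)) :
    Prop where
  measurable : ∀ Y ∈ L, Measurable Y
  lawInvariant : ∀ Y ∈ L, ∀ Z : Ω → ℝ, Measurable Z → IdentDistrib Z Y μ μ → Z ∈ L
  cone_mem : ∀ (w : Fin n → ℝ) (b : ℝ), 0 ≤ w → (fun ω => ∑ j, w j * X j ω + b) ∈ L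

/-- Cost functions: convex and non-negative on the real line, vanishing at `0`. -/
structure IsCostFunction (c : ℝ → ℝ) : Prop where
  convex : ConvexOn ℝ univ c
  nonneg : ∀ x, 0 ≤ c x
  zero : c 0 = 0

/-- The right derivative. -/
def rightDeriv (c : ℝ → ℝ) (x : ℝ) : ℝ := derivWithin c (Ioi x) x

/-- The left derivative. -/
def leftDeriv (c : ℝ → ℝ) (x : ℝ) : ℝ := derivWithin c (Iio x) x

/-- The initial exposure vector `a i • e i` of agent `i`. -/
def initialPosition {n : ℕ} (a : Fin n → ℝ) (i : Fin n) : Fin n → ℝ := Pi.single i (a i)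

/-- The total exposure `∑ j, |w j|`. -/
def totalExposure {n : ℕ} (w : Fin n → ℝ) : ℝ := ∑ j, |w j|

/-- The loss of agent `i` who holds the exposure vector `w` at the premium vector `p`. -/
def agentLoss {n : ℕ} (X : Fin n → Ω → ℝ) (a : Fin n → ℝ) (i : Fin n) (w p : Fin n → ℝ) :
    Ω → ℝ :=
  fun ω => ∑ j, w j * X j ω - ∑ j, (w j - initialPosition a i j) * p j

/-- The quantity that agent `i` minimizes: the risk of the loss plus the cost of changing the
total exposure. -/
def agentObjective {n : ℕ} (X : Fin n → Ω → ℝ) (a : Fin n → ℝ) (c : Fin n → ℝ → ℝ)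
    (ρ : Fin n → (Ω → ℝ) → ℝ) (p : Fin n → ℝ) (i : Fin n) (w : Fin n → ℝ) : ℝ :=
  ρ i (agentLoss X a i w p) + c i (totalExposure w - totalExposure (initialPosition a i))

/-- `(p, w 1, …, w n)` is an equilibrium of the market. -/
structure IsEquilibrium {n : ℕ} (X : Fin n → Ω → ℝ) (a : Fin n → ℝ) (c : Fin n → ℝ → ℝ)
    (ρ : Fin n → (Ω → ℝ) → ℝ) (p : Fin n → ℝ) (w : Fin n → Fin n → ℝ) : Prop where
  price_nonneg : 0 ≤ p
  position_nonneg : ∀ i, 0 ≤ w i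
  optimal : ∀ i, ∀ v : Fin n → ℝ, 0 ≤ v →
    agentObjective X a c ρ p i (w i) ≤ agentObjective X a c ρ p i v
  clearance : ∑ i, w i = ∑ i, initialPosition a i

end RiskSharing

end

noncomputable section

namespace RiskSharing

/-! ### Super-Pareto tails and the distribution function of a portfolio -/

section

variable {Ω : Type*} [MeasurableSpace Ω]

/-! Diversification hurts: a portfolio of total exposure `W` stochastically dominates the single
loss `W * X k`. Let `z` be the lower end point of the law, `T` the tail of `X k` at `τ = t / W`, and
`θ i = w i / W`. Since all losses are at least `z`, the event that the portfolio is at most `t`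
forces `X i ≤ z + (τ - z) / θ i` for every `i` with positive weight. Weak negative association
bounds the joint probability by a product, and concavity of the reciprocal tail bounds each factor
by `1 / (1 + θ i * r)` with `r = T / (1 - T)`. As the `θ i` sum to one, the product is at most `1 /
(1 + r) = 1 - T`, strictly so if two weights are positive and `T < 1`. This is
`IsWNAIDSuperPareto.measureReal_sum_le`.

Mild monotonicity is strict only for almost sure strict inequality. For continuous laws, the
quantile coupling of `exists_identDistrib_ae_lt` turns strict dominance into such an inequality for
a copy of the portfolio, which stays in the domain by law invariance.

In the market, moving the total exposure of an agent to a single loss leaves the cost unchanged and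
does not increase the risk. Hence only losses with the highest premium are held; by clearance all
losses are held, so premiums agree. Strictness then allows each agent only one loss, and clearance
yields a permutation. For distortion risk measures the remaining problem is convex in the
one-dimensional exposure, and its first-order condition gives the bounds on `p`. -/

theorem paretoMeasure_one_one_Ioi {u : ℝ} (hu : 1 ≤ u) :
    paretoMeasure 1 1 (Ioi u) = ENNReal.ofReal u⁻¹ := by
  have h0 : 0 < u := by linarith
  have hint : IntegrableOn (fun x : ℝ => x ^ (-2 : ℝ)) (Ioi u) :=
    integrableOn_Ioi_rpow_of_lt (by norm_num) h0
  rw [paretoMeasure, withDensity_apply _ measurableSet_Ioi,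
    setLIntegral_congr_fun (g := fun x : ℝ => ENNReal.ofReal (x ^ (-2 : ℝ))) measurableSet_Ioi,
    ← ofReal_integral_eq_lintegral_ofReal hint,
    integral_Ioi_rpow_of_lt (by norm_num) h0]
  · congr 1
    norm_num [Real.rpow_neg_one]
  · rw [Filter.EventuallyLE, ae_restrict_iff' measurableSet_Ioi]
    filter_upwards with x hx
    exact Real.rpow_nonneg (h0.trans hx).le _
  · intro x hx
    simp only
    rw [paretoPDF_of_le (hu.trans (le_of_lt hx))]
    norm_num

theorem paretoMeasure_one_one_Iio : paretoMeasure 1 1 (Iio 1) = 0 := by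
  rw [paretoMeasure, withDensity_apply _ measurableSet_Iio]
  exact lintegral_paretoPDF_of_le le_rfl

/-- A convex function on `[1, ∞)` that is increasing and non-constant is unbounded. -/
theorem exists_lt_of_convexOn_Ici {f : ℝ → ℝ} (hm : MonotoneOn f (Ici 1))
    (hf : ConvexOn ℝ (Ici 1) f)
    (hne : ∃ x ∈ Ici (1 : ℝ), ∃ y ∈ Ici (1 : ℝ), f x ≠ f y) (t : ℝ) :
    ∃ u : ℝ, 1 ≤ u ∧ t < f u := by
  obtain ⟨x, y, hx, hy, hxy, hfxy⟩ : ∃ x y : ℝ, 1 ≤ x ∧ 1 ≤ y ∧ x < y ∧ f x < f y := by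
    obtain ⟨x, hx, y, hy, hxy⟩ := hne
    rcases lt_trichotomy x y with h | h | h
    · exact ⟨x, y, hx, hy, h, lt_of_le_of_ne (hm hx hy h.le) hxy⟩
    · exact absurd (congrArg f h) hxy
    · exact ⟨y, x, hy, hx, h, lt_of_le_of_ne (hm hy hx h.le) hxy.symm⟩
  set s := (f y - f x) / (y - x) with hs
  have hs0 : 0 < s := div_pos (by linarith) (by linarith)
  -- Beyond `y` the function grows with slope at least `s`, and this `d` makes the gain `s * d = |t
  -- - f y| + s` exceed `t - f y`.
  set d := |t - f y| / s + 1 with hd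
  have hd0 : 0 < d := by positivity
  refine ⟨y + d, by linarith, ?_⟩
  have h1 := hf.slope_mono_adjacent (x := x) (y := y) (z := y + d) hx
    (show (1 : ℝ) ≤ y + d by linarith) hxy (by linarith)
  rw [← hs, add_sub_cancel_left, le_div_iff₀ hd0] at h1
  have h2 : s * d = |t - f y| + s := by rw [hd]; field_simp
  have h3 := le_abs_self (t - f y)
  linarith

/-- The lower end point and the tail of a super-Pareto law. The last property expresses the
concavity of the reciprocal of the tail function. -/
theorem IsSuperPareto.exists_tail_bound {μ : Measure Ω} [IsProbabilityMeasure μ] {X : Ω → ℝ}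
    (hXm : Measurable X) (hX : IsSuperPareto μ X) :
    ∃ z : ℝ, (∀ᵐ ω ∂μ, z ≤ X ω) ∧ (∀ t, 0 < μ.real {ω | t < X ω}) ∧
      ∀ t θ : ℝ, z ≤ t → 0 < θ → θ ≤ 1 →
        θ * μ.real {ω | t < X ω} / (1 - μ.real {ω | t < X ω} + θ * μ.real {ω | t < X ω}) ≤
          μ.real {ω | z + (t - z) / θ < X ω} := by
  obtain ⟨f, hm, hf, hne, hlaw⟩ := hX
  -- Measurability comes from the equality of laws: the push-forward by a function that is not
  -- almost everywhere measurable is zero by convention, whereas the law of `X` has mass one.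
  have hfm : AEMeasurable f (paretoMeasure 1 1) := by
    by_contra h
    rw [Measure.map_of_not_aemeasurable h] at hlaw
    have := Measure.isProbabilityMeasure_map (μ := μ) hXm.aemeasurable
    rw [hlaw] at this
    have h1 := this.measure_univ
    rw [Measure.coe_zero, Pi.zero_apply] at h1
    exact zero_ne_one h1
  have hpre : ∀ A : Set ℝ, MeasurableSet A → μ (X ⁻¹' A) = paretoMeasure 1 1 (f ⁻¹' A) := by
    intro A hA
    rw [← Measure.map_apply hXm hA, hlaw, Measure.map_apply_of_aemeasurable hfm hA]
  -- Since `f` may be flat near `1`, no inverse is used; this bound and the next bracket the tail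
  -- through points where `f` crosses the level.
  have hlow : ∀ t u : ℝ, 1 ≤ u → (∀ y, u < y → t < f y) → u⁻¹ ≤ μ.real {ω | t < X ω} := by
    intro t u hu h
    have h1 : paretoMeasure 1 1 (Ioi u) ≤ μ {ω | t < X ω} := by
      rw [show {ω | t < X ω} = X ⁻¹' Ioi t from rfl, hpre _ measurableSet_Ioi]
      exact measure_mono fun y hy => h y hy
    rw [paretoMeasure_one_one_Ioi hu] at h1
    exact (ENNReal.ofReal_le_iff_le_toReal (measure_ne_top _ _)).1 h1
  have hupp : ∀ t u : ℝ, 1 ≤ u → f u ≤ t → μ.real {ω | t < X ω} ≤ u⁻¹ := by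
    intro t u hu h
    have h1 : μ {ω | t < X ω} ≤ paretoMeasure 1 1 (Ioi u) := by
      rw [show {ω | t < X ω} = X ⁻¹' Ioi t from rfl, hpre _ measurableSet_Ioi]
      calc paretoMeasure 1 1 (f ⁻¹' Ioi t) ≤ paretoMeasure 1 1 (Ioi u ∪ Iio 1) := by
            refine measure_mono fun y hy => ?_
            by_contra hc
            simp only [mem_union, mem_Ioi, mem_Iio, not_or, not_lt] at hc
            have := hm (show y ∈ Ici 1 from hc.2) (show u ∈ Ici 1 from hu) hc.1
            exact absurd (show t < f y from hy) (by linarith)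
        _ ≤ _ := (measure_union_le _ _).trans (by simp [paretoMeasure_one_one_Iio])
    rw [paretoMeasure_one_one_Ioi hu] at h1
    exact ENNReal.toReal_le_of_le_ofReal (by positivity) h1
  refine ⟨f 1, ?_, ?_, ?_⟩
  · rw [ae_iff]
    simp only [not_le]
    rw [show {ω | X ω < f 1} = X ⁻¹' Iio (f 1) from rfl, hpre _ measurableSet_Iio]
    refine measure_mono_null (fun y hy => ?_) paretoMeasure_one_one_Iio
    by_contra hc
    simp only [mem_Iio, not_lt] at hc
    have := hm (mem_Ici.2 (le_refl (1 : ℝ))) (show y ∈ Ici 1 from hc) hc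
    exact absurd (show f y < f 1 from hy) (by linarith)
  · intro t
    obtain ⟨u, hu, htu⟩ := exists_lt_of_convexOn_Ici hm hf hne t
    exact lt_of_lt_of_le (by positivity) (hlow t u hu fun y hy =>
      htu.trans_le (hm hu (hu.trans hy.le) hy.le))
  · intro t θ ht hθ hθ1
    set T := μ.real {ω | t < X ω} with hT
    have hT0 : 0 < T := by
      obtain ⟨u, hu, htu⟩ := exists_lt_of_convexOn_Ici hm hf hne t
      exact lt_of_lt_of_le (by positivity) (hlow t u hu fun y hy =>
        htu.trans_le (hm hu (hu.trans hy.le) hy.le))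
    have hT1 : T ≤ 1 := measureReal_le_one
    -- This number is `1 + (1 / T - 1) / θ`, the point that the contraction `y ↦ 1 + θ * (y - 1)`
    -- sends to `1 / T`. For larger `y` the contracted point lies beyond `1 / T`, where `f` exceeds
    -- `t`; convexity along the segment from `1` to `y` then bounds `f y` from below.
    have hu1 : 1 ≤ (1 - T + θ * T) / (θ * T) := by
      rw [le_div_iff₀ (by positivity)]; linarith
    have := hlow (f 1 + (t - f 1) / θ) ((1 - T + θ * T) / (θ * T)) hu1 ?_
    · rwa [inv_div] at this
    intro y hy
    have hy1 : 1 ≤ y := hu1.trans hy.le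
    have hv1 : 1 ≤ 1 + θ * (y - 1) := by nlinarith
    have hyT : 1 < (1 + θ * (y - 1)) * T := by
      rw [div_lt_iff₀ (by positivity)] at hy
      nlinarith
    have hfu : t < f (1 + θ * (y - 1)) := by
      by_contra! hc
      have := hupp t _ hv1 hc
      rw [← hT, le_inv_comm₀ hT0 (by linarith), le_inv_comm₀ (by linarith) hT0] at this
      have h2 : (1 + θ * (y - 1)) * T ≤ 1 := by
        rw [← le_div_iff₀' (by linarith), one_div]; exact this
      linarith
    have hc := hf.2 (mem_Ici.2 (le_refl (1 : ℝ))) (show y ∈ Ici 1 from hy1)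
      (show 0 ≤ 1 - θ by linarith) hθ.le (by ring)
    simp only [smul_eq_mul] at hc
    rw [show (1 - θ) * 1 + θ * y = 1 + θ * (y - 1) by ring] at hc
    have : (t - f 1) / θ < f y - f 1 := by
      rw [div_lt_iff₀ hθ]; nlinarith
    linarith

theorem one_add_sum_le_prod_one_add {ι : Type*} (s : Finset ι) {x : ι → ℝ}
    (hx : ∀ i ∈ s, 0 ≤ x i) : 1 + ∑ i ∈ s, x i ≤ ∏ i ∈ s, (1 + x i) := by
  classical
  induction s using Finset.induction_on with
  | empty => simp
  | insert i s hi ih =>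
    rw [Finset.sum_insert hi, Finset.prod_insert hi]
    have h1 := ih fun j hj => hx j (Finset.mem_insert_of_mem hj)
    have h2 := hx i (Finset.mem_insert_self i s)
    have h3 : 0 ≤ ∑ j ∈ s, x j := Finset.sum_nonneg fun j hj => hx j (Finset.mem_insert_of_mem hj)
    nlinarith

/-- Splitting off one factor leaves a cross term between `x i` and the other summands, which is
positive because another index exists. -/
theorem one_add_sum_lt_prod_one_add {ι : Type*} (s : Finset ι) {x : ι → ℝ}
    (hx : ∀ i ∈ s, 0 < x i) (hs : s.Nontrivial) : 1 + ∑ i ∈ s, x i < ∏ i ∈ s, (1 + x i) := by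
  classical
  obtain ⟨i, hi, j, hj, hij⟩ := hs
  have hj' : j ∈ s.erase i := Finset.mem_erase.2 ⟨hij.symm, hj⟩
  have hx' : ∀ k ∈ s.erase i, 0 < x k := fun k hk => hx k (Finset.mem_of_mem_erase hk)
  rw [← Finset.add_sum_erase s x hi, ← Finset.mul_prod_erase s (fun k => 1 + x k) hi]
  have h1 := one_add_sum_le_prod_one_add (s.erase i) fun k hk => (hx' k hk).le
  have h2 := hx i hi
  have h3 : 0 < ∑ k ∈ s.erase i, x k := Finset.sum_pos hx' ⟨j, hj'⟩
  nlinarith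

theorem prod_div_eq_inv_prod {ι : Type*} (s : Finset ι) {θ : ι → ℝ} {T : ℝ} (hT1 : T < 1) :
    ∏ i ∈ s, (1 - T) / (1 - T + θ i * T) = (∏ i ∈ s, (1 + θ i * (T / (1 - T))))⁻¹ := by
  have h : 1 - T ≠ 0 := by linarith
  rw [← Finset.prod_inv_distrib]
  refine Finset.prod_congr rfl fun i _ => ?_
  rw [← inv_div]
  congr 1
  field_simp

/-- With `r = T / (1 - T)` the product is the inverse of `∏ (1 + θ i * r)`, which is at least `1 + r
= 1 / (1 - T)`. The case `T = 1`, where `r` is not available, is direct because the factors vanish.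
-/
theorem prod_div_le_of_sum_eq_one {ι : Type*} (s : Finset ι) {θ : ι → ℝ} {T : ℝ} (hT0 : 0 < T)
    (hT1 : T ≤ 1) (hθ : ∀ i ∈ s, 0 < θ i) (hsum : ∑ i ∈ s, θ i = 1) :
    ∏ i ∈ s, (1 - T) / (1 - T + θ i * T) ≤ 1 - T := by
  rcases hT1.eq_or_lt with rfl | hT1
  · obtain ⟨i, hi⟩ : s.Nonempty := by
      by_contra h
      simp [Finset.not_nonempty_iff_eq_empty.1 h] at hsum
    exact (Finset.prod_eq_zero hi (by simp)).le.trans (by simp)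
  · have h1 : 0 < 1 - T := by linarith
    have h2 := one_add_sum_le_prod_one_add s (x := fun i => θ i * (T / (1 - T)))
      fun i hi => by have := hθ i hi; positivity
    rw [← Finset.sum_mul, hsum, one_mul] at h2
    rw [prod_div_eq_inv_prod s hT1, inv_le_comm₀ (lt_of_lt_of_le (by positivity) h2) h1]
    exact le_trans (le_of_eq (by field_simp; ring)) h2

theorem prod_div_lt_of_sum_eq_one {ι : Type*} (s : Finset ι) {θ : ι → ℝ} {T : ℝ} (hT0 : 0 < T)
    (hT1 : T < 1) (hθ : ∀ i ∈ s, 0 < θ i) (hsum : ∑ i ∈ s, θ i = 1) (hs : s.Nontrivial) :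
    ∏ i ∈ s, (1 - T) / (1 - T + θ i * T) < 1 - T := by
  have h1 : 0 < 1 - T := by linarith
  have h2 := one_add_sum_lt_prod_one_add s (x := fun i => θ i * (T / (1 - T)))
    (fun i hi => by have := hθ i hi; positivity) hs
  rw [← Finset.sum_mul, hsum, one_mul] at h2
  rw [prod_div_eq_inv_prod s hT1, inv_lt_comm₀ (lt_trans (by positivity) h2) h1]
  exact lt_of_le_of_lt (le_of_eq (by field_simp; ring)) h2

/-- Weakly negatively associated variables are negatively lower orthant dependent. -/
theorem WeaklyNegativelyAssociated.measure_forall_le_prod {μ : Measure Ω} [IsProbabilityMeasure μ]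
    {n : ℕ} {X : Fin n → Ω → ℝ} (hXm : ∀ i, Measurable (X i))
    (hX : WeaklyNegativelyAssociated μ X) (s : Finset (Fin n)) (x : Fin n → ℝ) :
    μ {ω | ∀ i ∈ s, X i ω ≤ x i} ≤ ∏ i ∈ s, μ {ω | X i ω ≤ x i} := by
  induction s using Finset.induction_on with
  | empty => simp
  | insert i s hi ih =>
    rw [Finset.prod_insert hi]
    have hsplit : {ω | ∀ j ∈ insert i s, X j ω ≤ x j} =
        {ω | X i ω ≤ x i} ∩ {ω | ∀ j ∈ s, X j ω ≤ x j} := by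
      ext ω; simp
    rw [hsplit]
    by_cases h0 : μ {ω | X i ω ≤ x i} = 0
    · rw [measure_mono_null inter_subset_left h0]; exact zero_le
    -- A lower orthant in the coordinates of `s` is a decreasing set, so weak negative association
    -- splits off the index `i`.
    set S : Set ({j : Fin n // j ≠ i} → ℝ) := {y | ∀ j : {j : Fin n // j ≠ i}, (j : Fin n) ∈ s →
      y j ≤ x j} with hS
    have hSm : MeasurableSet S := by
      rw [show S = ⋂ j : {j : Fin n // j ≠ i}, {y | (j : Fin n) ∈ s → y j ≤ x j} by
        ext y; simp [hS]]
      refine MeasurableSet.iInter fun j => ?_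
      by_cases hj : (j : Fin n) ∈ s
      · simpa [hj] using measurableSet_le (measurable_pi_apply j) measurable_const
      · simp [hj]
    have hSl : IsLowerSet S := fun y y' hy h j hj => (hy j).trans (h j hj)
    have hSe : {ω | (fun j : {j : Fin n // j ≠ i} => X j ω) ∈ S} =
        {ω | ∀ j ∈ s, X j ω ≤ x j} := by
      ext ω
      refine ⟨fun h j hj => h ⟨j, fun e => hi (e ▸ hj)⟩ hj, fun h j hj => h j hj⟩
    have h1 := hX i S hSm hSl (x i) (pos_iff_ne_zero.2 h0)
    rw [hSe, cond_apply (measurableSet_le (hXm i) measurable_const)] at h1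
    rw [ENNReal.inv_mul_le_iff h0 (measure_ne_top _ _)] at h1
    exact h1.trans (mul_le_mul_right ih _)

theorem IsWNAIDSuperPareto.measurable_sum {μ : Measure Ω} {n : ℕ} {X : Fin n → Ω → ℝ}
    (hX : IsWNAIDSuperPareto μ X) (w : Fin n → ℝ) : Measurable fun ω => ∑ j, w j * X j ω :=
  Finset.measurable_sum _ fun j _ => (hX.measurable j).const_mul _

theorem measureReal_le_eq_one_sub {μ : Measure Ω} [IsProbabilityMeasure μ] {Y : Ω → ℝ}
    (hY : Measurable Y) (t : ℝ) : μ.real {ω | Y ω ≤ t} = 1 - μ.real {ω | t < Y ω} := by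
  rw [← probReal_compl_eq_one_sub (measurableSet_lt measurable_const hY)]
  congr 1; ext ω; simp

/-- The distribution function of a portfolio is dominated by that of a single loss with the same
total exposure, strictly so for portfolios with at least two positive positions. -/
theorem IsWNAIDSuperPareto.measureReal_sum_le {μ : Measure Ω} [IsProbabilityMeasure μ] {n : ℕ}
    {X : Fin n → Ω → ℝ} (hX : IsWNAIDSuperPareto μ X) {w : Fin n → ℝ} (hw : 0 ≤ w) (k : Fin n)
    (t : ℝ) :
    μ.real {ω | ∑ j, w j * X j ω ≤ t} ≤ μ.real {ω | (∑ j, w j) * X k ω ≤ t} ∧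
      ((∃ i j, i ≠ j ∧ 0 < w i ∧ 0 < w j) → 0 < μ.real {ω | (∑ j, w j) * X k ω ≤ t} →
        μ.real {ω | ∑ j, w j * X j ω ≤ t} < μ.real {ω | (∑ j, w j) * X k ω ≤ t}) := by
  set W := ∑ j, w j with hW
  have hWn : 0 ≤ W := Finset.sum_nonneg fun j _ => hw j
  rcases hWn.eq_or_lt with hW0 | hW0
  · have hw0 : ∀ j, w j = 0 := fun j =>
      (Finset.sum_eq_zero_iff_of_nonneg fun j _ => hw j).1 hW0.symm j (Finset.mem_univ j)
    refine ⟨by simp [hw0, ← hW0], ?_⟩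
    rintro ⟨i, -, -, hi, -⟩
    simp [hw0] at hi
  obtain ⟨z, hz, hTpos, hTail⟩ := (hX.superPareto k).exists_tail_bound (hX.measurable k)
  have hz' : ∀ᵐ ω ∂μ, ∀ i, z ≤ X i ω := by
    refine ae_all_iff.2 fun i => ?_
    exact (hX.identDistrib k i).ae_mem_snd (t := Ici z) measurableSet_Ici hz
  set τ := t / W with hτ
  have hrhs : {ω | W * X k ω ≤ t} = {ω | X k ω ≤ τ} := by
    ext ω; rw [mem_ofPred_eq, mem_ofPred_eq, hτ, le_div_iff₀ hW0, mul_comm]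
  rw [hrhs]
  have hsumz : ∀ᵐ ω ∂μ, W * z ≤ ∑ j, w j * X j ω := by
    filter_upwards [hz'] with ω hω
    rw [hW, Finset.sum_mul]
    exact Finset.sum_le_sum fun j _ => mul_le_mul_of_nonneg_left (hω j) (hw j)
  -- The tail bound needs `z ≤ τ`; below `z` both probabilities vanish.
  rcases lt_or_ge τ z with hlt | hge
  · have h1 : μ.real {ω | ∑ j, w j * X j ω ≤ t} = 0 := by
      rw [measureReal_eq_zero_iff]
      refine measure_mono_null (fun ω hω => ?_) (ae_iff.1 hsumz)
      rw [hτ, div_lt_iff₀ hW0] at hlt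
      rw [mem_ofPred_eq] at hω ⊢
      linarith
    have h2 : μ.real {ω | X k ω ≤ τ} = 0 := by
      rw [measureReal_eq_zero_iff]
      refine measure_mono_null (fun ω hω => ?_) (ae_iff.1 hz)
      rw [mem_ofPred_eq] at hω ⊢
      linarith
    rw [h1, h2]
    exact ⟨le_rfl, fun _ h => absurd h (lt_irrefl _)⟩
  -- Only positive weights enter the product, since the thresholds divide by `θ i`.
  set s : Finset (Fin n) := Finset.univ.filter fun i => 0 < w i with hs
  set θ : Fin n → ℝ := fun i => w i / W with hθ
  have hθpos : ∀ i ∈ s, 0 < θ i := fun i hi => div_pos (Finset.mem_filter.1 hi).2 hW0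
  have hsumθ : ∑ i ∈ s, θ i = 1 := by
    rw [← Finset.sum_div, div_eq_one_iff_eq hW0.ne', hW]
    refine Finset.sum_subset (Finset.subset_univ _) fun i _ hi => ?_
    exact le_antisymm (by simpa [hs] using hi) (hw i)
  have hθle : ∀ i ∈ s, θ i ≤ 1 := fun i hi => by
    rw [← hsumθ]; exact Finset.single_le_sum (fun j hj => (hθpos j hj).le) hi
  set T := μ.real {ω | τ < X k ω} with hT
  have hT0 : 0 < T := hTpos τ
  have hT1 : T ≤ 1 := measureReal_le_one
  have hF : μ.real {ω | X k ω ≤ τ} = 1 - T := measureReal_le_eq_one_sub (hX.measurable k) τ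
  have hmain : μ.real {ω | ∑ j, w j * X j ω ≤ t} ≤ ∏ i ∈ s, (1 - T) / (1 - T + θ i * T) := by
    have h1 : μ {ω | ∑ j, w j * X j ω ≤ t} ≤
        μ {ω | ∀ i ∈ s, X i ω ≤ z + (τ - z) / θ i} := by
      refine measure_mono_ae ?_
      filter_upwards [hz'] with ω hω (hle : _ ≤ t) i hi
      have h2 : w i * (X i ω - z) ≤ ∑ j, w j * (X j ω - z) :=
        Finset.single_le_sum (f := fun j => w j * (X j ω - z))
          (fun j _ => mul_nonneg (hw j) (sub_nonneg.2 (hω j))) (Finset.mem_univ i)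
      simp only [mul_sub, Finset.sum_sub_distrib, ← Finset.sum_mul, ← hW] at h2
      have h3 : X i ω - z ≤ (τ - z) / θ i := by
        rw [le_div_iff₀ (hθpos i hi), hθ, hτ]
        have : (X i ω - z) * (w i / W) = (w i * X i ω - w i * z) / W := by ring
        rw [this, div_le_iff₀ hW0, sub_mul, div_mul_cancel₀ _ hW0.ne']
        linarith
      linarith
    have h2 := h1.trans (hX.weaklyNegativelyAssociated.measure_forall_le_prod hX.measurable s
      fun i => z + (τ - z) / θ i)
    have h3 : μ.real {ω | ∑ j, w j * X j ω ≤ t} ≤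
        ∏ i ∈ s, μ.real {ω | X i ω ≤ z + (τ - z) / θ i} := by
      have := ENNReal.toReal_mono (ENNReal.prod_ne_top fun i _ => measure_ne_top _ _) h2
      rwa [ENNReal.toReal_prod] at this
    refine h3.trans (Finset.prod_le_prod (fun i _ => measureReal_nonneg) fun i hi => ?_)
    have h4 : μ.real {ω | X i ω ≤ z + (τ - z) / θ i} =
        μ.real {ω | X k ω ≤ z + (τ - z) / θ i} :=
      congrArg ENNReal.toReal ((hX.identDistrib i k).measure_mem_eq (s := Iic _) measurableSet_Iic)
    rw [h4, measureReal_le_eq_one_sub (hX.measurable k)]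
    have h5 := hTail τ (θ i) hge (hθpos i hi) (hθle i hi)
    rw [← hT] at h5
    have h6 : 0 < 1 - T + θ i * T := by have := mul_pos (hθpos i hi) hT0; linarith
    have h7 : (1 - T) / (1 - T + θ i * T) = 1 - θ i * T / (1 - T + θ i * T) := by
      rw [eq_sub_iff_add_eq, ← add_div, div_self h6.ne']
    linarith
  rw [hF]
  refine ⟨hmain.trans (prod_div_le_of_sum_eq_one s hT0 hT1 hθpos hsumθ), ?_⟩
  rintro ⟨i, j, hij, hi, hj⟩ h0
  exact hmain.trans_lt (prod_div_lt_of_sum_eq_one s hT0 (by linarith) hθpos hsumθ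
    ⟨i, by simp [hs, hi], j, by simp [hs, hj], hij⟩)

end

/-! ### Probability integral transform and the quantile coupling -/

section

variable {Ω : Type*} [MeasurableSpace Ω]

theorem continuous_cdf (ν : Measure ℝ) [IsProbabilityMeasure ν] [NullSingletonClass ν] :
    Continuous (cdf ν) := by
  refine continuous_iff_continuousAt.2 fun x => ?_
  rw [(monotone_cdf ν).continuousAt_iff_leftLim_eq_rightLim, (cdf ν).rightLim_eq]
  have h := (cdf ν).measure_singleton x
  rw [measure_cdf, measure_singleton] at h
  exact le_antisymm ((monotone_cdf ν).leftLim_le le_rfl)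
    (by linarith [ENNReal.ofReal_eq_zero.1 h.symm])

theorem exists_cdf_eq (ν : Measure ℝ) [IsProbabilityMeasure ν] [NullSingletonClass ν] {u : ℝ}
    (hu : u ∈ Ioo (0 : ℝ) 1) : ∃ x, cdf ν x = u := by
  obtain ⟨a, ha⟩ := ((tendsto_cdf_atBot ν).eventually_lt_const hu.1).exists
  obtain ⟨b, hb⟩ := ((tendsto_cdf_atTop ν).eventually_const_lt hu.2).exists
  exact mem_range_of_exists_le_of_exists_ge (continuous_cdf ν) ⟨a, ha.le⟩ ⟨b, hb.le⟩

/-- The probability integral transform: the distribution function of an atomless law is uniformly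
distributed under this law. -/
theorem measureReal_cdf_le (ν : Measure ℝ) [IsProbabilityMeasure ν] [NullSingletonClass ν] {u : ℝ}
    (hu : u ∈ Icc (0 : ℝ) 1) : ν.real {x | cdf ν x ≤ u} = u := by
  have hupper : ∀ v ∈ Ioo (0 : ℝ) 1, u < v → ν.real {x | cdf ν x ≤ u} ≤ v := by
    intro v hv huv
    obtain ⟨x, hx⟩ := exists_cdf_eq ν hv
    rw [← hx, cdf_eq_real]
    refine measureReal_mono fun y (hy : cdf ν y ≤ u) => ?_
    by_contra hc
    have := monotone_cdf ν (not_le.1 hc).le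
    linarith
  have hlower : ∀ v ∈ Ioo (0 : ℝ) 1, v ≤ u → v ≤ ν.real {x | cdf ν x ≤ u} := by
    intro v hv hvu
    obtain ⟨x, hx⟩ := exists_cdf_eq ν hv
    rw [← hx, cdf_eq_real]
    exact measureReal_mono fun y hy => (monotone_cdf ν hy).trans (hx.trans_le hvu)
  refine le_antisymm ?_ ?_
  -- Only levels inside `(0, 1)` are known to be values of the distribution function, so `u` is
  -- approached by such levels and the end points are treated apart.
  · rcases hu.2.eq_or_lt with rfl | h1
    · exact measureReal_le_one
    · refine le_of_forall_gt_imp_ge_of_dense fun v hv => ?_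
      rcases lt_or_ge v 1 with h | h
      · exact hupper v ⟨hu.1.trans_lt hv, h⟩ hv
      · exact measureReal_le_one.trans h
  · rcases hu.1.eq_or_lt with rfl | h0
    · exact measureReal_nonneg
    · refine le_of_forall_lt_imp_le_of_dense fun v hv => ?_
      rcases lt_or_ge 0 v with h | h
      · exact hlower v ⟨h, hv.trans_le hu.2⟩ hv.le
      · exact h.trans measureReal_nonneg

theorem ae_cdf_mem_Ioo (ν : Measure ℝ) [IsProbabilityMeasure ν] [NullSingletonClass ν] :
    ∀ᵐ x ∂ν, cdf ν x ∈ Ioo (0 : ℝ) 1 := by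
  have h0 : ∀ᵐ x ∂ν, 0 < cdf ν x := by
    rw [ae_iff]
    simp only [not_lt]
    rw [← measureReal_eq_zero_iff]
    exact measureReal_cdf_le ν (by simp)
  have hm : Measurable (cdf ν) := (monotone_cdf ν).measurable
  have h1 : ∀ᵐ x ∂ν, cdf ν x < 1 := by
    rw [ae_iff]
    simp only [not_lt]
    rw [← measureReal_eq_zero_iff]
    refine le_antisymm (le_of_forall_gt_imp_ge_of_dense fun e he => ?_) measureReal_nonneg
    rcases lt_or_ge e 1 with h | h
    · have h2 := measureReal_cdf_le ν (u := 1 - e) ⟨by linarith, by linarith⟩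
      have h3 : ν.real {x | 1 ≤ cdf ν x} ≤ ν.real {x | cdf ν x ≤ 1 - e}ᶜ :=
        
        measureReal_mono fun x hx => by
          rw [mem_compl_iff, mem_ofPred_eq, not_le]
          rw [mem_ofPred_eq] at hx
          linarith
      rw [probReal_compl_eq_one_sub (measurableSet_le hm measurable_const), h2] at h3
      linarith
    · exact measureReal_le_one.trans h
  filter_upwards [h0, h1] with x hx0 hx1 using ⟨hx0, hx1⟩

/-- The generalised inverse of a distribution function. -/
def quantile (ν : Measure ℝ) (u : ℝ) : ℝ := sInf {x | u ≤ cdf ν x}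

/-- Right continuity of the distribution function makes the infimum attained. Levels strictly
between `0` and `1` make the set nonempty and bounded below, so that `sInf` is a true infimum. -/
theorem quantile_le_iff (ν : Measure ℝ) {u : ℝ} (hu : u ∈ Ioo (0 : ℝ) 1) (x : ℝ) :
    quantile ν u ≤ x ↔ u ≤ cdf ν x := by
  obtain ⟨a, ha⟩ := ((tendsto_cdf_atBot ν).eventually_lt_const hu.1).exists
  obtain ⟨b, hb⟩ := ((tendsto_cdf_atTop ν).eventually_const_lt hu.2).exists
  have hbdd : BddBelow {x | u ≤ cdf ν x} := by
    refine ⟨a, fun y (hy : u ≤ _) => ?_⟩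
    by_contra hc
    have := monotone_cdf ν (not_le.1 hc).le
    linarith
  refine ⟨fun h => ?_, fun h => csInf_le hbdd h⟩
  refine ge_of_tendsto ((cdf ν).right_continuous x |>.mono_left
    (nhdsWithin_mono x Ioi_subset_Ici_self)) ?_
  filter_upwards [self_mem_nhdsWithin] with y hy
  obtain ⟨v, hv, hvy⟩ := exists_lt_of_csInf_lt ⟨b, hb.le⟩ (h.trans_lt hy)
  exact le_trans hv (monotone_cdf ν hvy.le)

/-- If the law of `Y` is atomless and the distribution function of `Z` is strictly below that of
`Y` wherever the latter is positive, then some copy of `Z` is almost surely larger than `Y`. -/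
theorem exists_identDistrib_ae_lt {μ : Measure Ω} [IsProbabilityMeasure μ] {Y Z : Ω → ℝ}
    (hY : Measurable Y) (hZ : Measurable Z) (hatom : ∀ x, μ {ω | Y ω = x} = 0)
    (hlt : ∀ t, 0 < μ.real {ω | Y ω ≤ t} → μ.real {ω | Z ω ≤ t} < μ.real {ω | Y ω ≤ t}) :
    ∃ Z' : Ω → ℝ, Measurable Z' ∧ IdentDistrib Z' Z μ μ ∧ ∀ᵐ ω ∂μ, Y ω < Z' ω := by
  classical
  set ν := μ.map Y with hν
  set κ := μ.map Z with hκ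
  have : IsProbabilityMeasure ν := Measure.isProbabilityMeasure_map hY.aemeasurable
  have : IsProbabilityMeasure κ := Measure.isProbabilityMeasure_map hZ.aemeasurable
  have : NullSingletonClass ν := ⟨fun x => by
    rw [hν, Measure.map_apply hY (measurableSet_singleton x)]; exact hatom x⟩
  have hcY : ∀ t, cdf ν t = μ.real {ω | Y ω ≤ t} := fun t => by
    rw [cdf_eq_real, hν, map_measureReal_apply hY measurableSet_Iic]; rfl
  have hcZ : ∀ t, cdf κ t = μ.real {ω | Z ω ≤ t} := fun t => by
    rw [cdf_eq_real, hκ, map_measureReal_apply hZ measurableSet_Iic]; rfl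
  have hFm : Measurable (cdf ν) := (monotone_cdf ν).measurable
  have hAm : MeasurableSet {y | cdf ν y ∈ Ioo (0 : ℝ) 1} := hFm measurableSet_Ioo
  -- The uniform variable fed into the quantile of `Z` is the distribution function of `Y` at `Y`
  -- itself, so the copy lives on `Ω`. The value `0` is taken only on a null set and keeps `q`
  -- measurable.
  set q : ℝ → ℝ := fun y => if cdf ν y ∈ Ioo (0 : ℝ) 1 then quantile κ (cdf ν y) else 0 with hq
  have hqm : Measurable q := by
    refine measurable_of_Iic fun x => ?_
    have : q ⁻¹' Iic x = ({y | cdf ν y ∈ Ioo (0 : ℝ) 1} ∩ {y | cdf ν y ≤ cdf κ x}) ∪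
        ({y | cdf ν y ∈ Ioo (0 : ℝ) 1}ᶜ ∩ {_y | 0 ≤ x}) := by
      ext y
      by_cases hy : cdf ν y ∈ Ioo (0 : ℝ) 1
      · have := quantile_le_iff κ hy x
        simp [hq, hy, this, -mem_Ioo]
      · simp [hq, hy, -mem_Ioo]
    rw [this]
    exact (hAm.inter (measurableSet_le hFm measurable_const)).union
      (hAm.compl.inter (MeasurableSet.const _))
  have hae := ae_cdf_mem_Ioo ν
  have : IsProbabilityMeasure (ν.map q) := Measure.isProbabilityMeasure_map hqm.aemeasurable
  refine ⟨q ∘ Y, hqm.comp hY, ⟨(hqm.comp hY).aemeasurable, hZ.aemeasurable, ?_⟩, ?_⟩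
  · rw [← Measure.map_map hqm hY, ← hν, ← hκ, ← Measure.cdf_eq_iff]
    ext x
    rw [cdf_eq_real, map_measureReal_apply hqm measurableSet_Iic,
      ← measureReal_cdf_le ν (u := cdf κ x) ⟨cdf_nonneg _ _, cdf_le_one _ _⟩]
    refine measureReal_congr ?_
    filter_upwards [hae] with y hy
    have h : q y ≤ x ↔ cdf ν y ≤ cdf κ x := by
      simp only [hq, if_pos hy]; exact quantile_le_iff κ hy x
    exact propext h
  · filter_upwards [ae_of_ae_map hY.aemeasurable hae] with ω hω
    have h1 := hlt (Y ω) (by rw [← hcY]; exact hω.1)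
    rw [← hcY, ← hcZ] at h1
    simp only [Function.comp, hq, if_pos hω]
    by_contra! hc
    exact absurd ((quantile_le_iff κ hω _).1 hc) (not_le.2 h1)

end

/-! ### Affine behaviour of distortion risk measures -/

section

variable {Ω : Type*} [MeasurableSpace Ω]

/-- A translation by `b` moves the reference step from `0` to `b`; the signed length in between is
what it adds to the risk. -/
theorem integrable_indicator_Iic_sub (b : ℝ) :
    Integrable (fun x : ℝ => (Iic b).indicator 1 x - (Iic 0).indicator (1 : ℝ → ℝ) x) ∧
      ∫ x : ℝ, ((Iic b).indicator 1 x - (Iic 0).indicator (1 : ℝ → ℝ) x) = b := by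
  rcases le_total 0 b with hb | hb
  · have h : (fun x : ℝ => (Iic b).indicator 1 x - (Iic 0).indicator (1 : ℝ → ℝ) x) =
        (Ioc 0 b).indicator 1 := by
      ext x
      simp only [indicator, mem_Iic, mem_Ioc, Pi.one_apply]
      grind
    rw [h]
    refine ⟨(integrable_indicator_iff measurableSet_Ioc).2 ((integrable_const (1 : ℝ))), ?_⟩
    rw [integral_indicator measurableSet_Ioc]
    simp [hb]
  · have h : (fun x : ℝ => (Iic b).indicator 1 x - (Iic 0).indicator (1 : ℝ → ℝ) x) =
        fun x => -(Ioc b 0).indicator (1 : ℝ → ℝ) x := by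
      ext x
      simp only [indicator, mem_Iic, mem_Ioc, Pi.one_apply]
      grind
    rw [h]
    refine ⟨((integrable_indicator_iff measurableSet_Ioc).2 ((integrable_const (1 : ℝ)))).neg, ?_⟩
    rw [integral_neg, integral_indicator measurableSet_Ioc]
    simp [hb]

/-- A distortion risk measure as a single integral. -/
theorem integral_sub_indicator_Iic {H : ℝ → ℝ} (h1 : IntegrableOn (fun x => H x - 1) (Iic 0))
    (h2 : IntegrableOn H (Ioi 0)) :
    Integrable (fun x => H x - (Iic 0).indicator (1 : ℝ → ℝ) x) ∧
      (∫ x in Iic (0 : ℝ), (H x - 1)) + ∫ x in Ioi (0 : ℝ), H x =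
        ∫ x, (H x - (Iic 0).indicator (1 : ℝ → ℝ) x) := by
  have e1 : EqOn (fun x => H x - (Iic 0).indicator (1 : ℝ → ℝ) x) (fun x => H x - 1) (Iic 0) := by
    intro x hx; simp [indicator_of_mem hx]
  have e2 : EqOn (fun x => H x - (Iic 0).indicator (1 : ℝ → ℝ) x) H (Ioi 0) := by
    intro x hx
    have : x ∉ Iic (0 : ℝ) := by simpa using hx
    simp [indicator_of_notMem this]
  have i1 := h1.congr_fun e1.symm measurableSet_Iic
  have i2 := h2.congr_fun e2.symm measurableSet_Ioi
  have hI : Integrable (fun x => H x - (Iic 0).indicator (1 : ℝ → ℝ) x) := by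
    rw [← integrableOn_univ, ← Iic_union_Ioi (a := (0 : ℝ))]
    exact i1.union i2
  refine ⟨hI, ?_⟩
  rw [← setIntegral_congr_fun measurableSet_Iic e1, ← setIntegral_congr_fun measurableSet_Ioi e2,
    intervalIntegral.integral_Iic_add_Ioi i1 i2]

/-- Distortion risk measures are positively homogeneous and translation invariant. -/
theorem IsDistortionOn.apply_mul_add {μ : Measure Ω} [IsProbabilityMeasure μ] {L : Set (Ω → ℝ)}
    {ρ : (Ω → ℝ) → ℝ} (hρ : IsDistortionOn μ L ρ) {Y : Ω → ℝ} (hY : Y ∈ L) {l b : ℝ} (hl : 0 ≤ l)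
    (hYL : (fun ω => l * Y ω + b) ∈ L) : ρ (fun ω => l * Y ω + b) = l * ρ Y + b := by
  obtain ⟨h, -, h0, h1, hρ⟩ := hρ
  obtain ⟨i1, i2, e⟩ := hρ Y hY
  obtain ⟨j1, j2, e'⟩ := hρ _ hYL
  obtain ⟨hi, he⟩ := integral_sub_indicator_Iic i1 i2
  obtain ⟨hj, he'⟩ := integral_sub_indicator_Iic j1 j2
  obtain ⟨hk, hb⟩ := integrable_indicator_Iic_sub b
  rw [e, he, e', he']
  rcases hl.eq_or_lt with rfl | hl
  -- For a constant loss the distorted tail is a step at `b`, and it agrees with the indicator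
  -- except at `b`, so no continuity of `h` is involved.
  · rw [zero_mul, zero_add]
    refine Eq.trans ?_ hb
    refine integral_congr_ae ?_
    filter_upwards [compl_mem_ae_iff.2 (measure_singleton (μ := volume) b)] with x hx
    rcases lt_or_gt_of_ne (show x ≠ b from hx) with hxb | hxb
    · have : x ∈ Iic b := hxb.le
      simp [hxb, h1, indicator_of_mem this]
    · have : x ∉ Iic b := not_le.2 hxb
      simp [hxb.not_gt, h0, indicator_of_notMem this]
  · set φ : ℝ → ℝ := fun x => h (μ.real {ω | x < Y ω}) - (Iic 0).indicator (1 : ℝ → ℝ) x with hφ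
    have hpt : (fun x => h (μ.real {ω | x < l * Y ω + b}) - (Iic 0).indicator (1 : ℝ → ℝ) x) =
        fun x => φ ((x - b) / l) +
          ((Iic b).indicator 1 x - (Iic 0).indicator (1 : ℝ → ℝ) x) := by
      ext x
      have s1 : {ω | x < l * Y ω + b} = {ω | (x - b) / l < Y ω} := by
        ext ω
        simp only [mem_ofPred_eq, div_lt_iff₀ hl]
        constructor <;> intro <;> linarith
      have s2 : (Iic 0).indicator (1 : ℝ → ℝ) ((x - b) / l) = (Iic b).indicator 1 x := by
        have : (x - b) / l ≤ 0 ↔ x ≤ b := by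
          rw [div_le_iff₀ hl, zero_mul, sub_nonpos]
        simp only [indicator, mem_Iic, this, Pi.one_apply]
      simp only [hφ, s1, s2]
      ring
    have hφi : Integrable (fun x => φ ((x - b) / l)) :=
      (hi.comp_div hl.ne').comp_sub_right b
    rw [hpt, integral_add hφi hk, hb,
      integral_sub_right_eq_self (μ := volume) (fun x => φ (x / l)) b,
      Measure.integral_comp_div, abs_of_pos hl, smul_eq_mul]

end

/-! ### Positions, objectives and the loss domain -/

section

variable {Ω : Type*}

theorem sum_single_mul {n : ℕ} (k : Fin n) (l : ℝ) (x : Fin n → ℝ) :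
    ∑ j, (Pi.single k l : Fin n → ℝ) j * x j = l * x k := by
  rw [Finset.sum_eq_single k (fun j _ hj => by simp [hj]) (by simp)]
  simp

theorem totalExposure_of_nonneg {n : ℕ} {w : Fin n → ℝ} (hw : 0 ≤ w) :
    totalExposure w = ∑ j, w j :=
  Finset.sum_congr rfl fun j _ => abs_of_nonneg (hw j)

theorem totalExposure_single {n : ℕ} (k : Fin n) {l : ℝ} (hl : 0 ≤ l) :
    totalExposure (Pi.single k l : Fin n → ℝ) = l := by
  rw [totalExposure_of_nonneg (Pi.single_nonneg.2 hl)]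
  simp

theorem agentLoss_eq {n : ℕ} (X : Fin n → Ω → ℝ) (a : Fin n → ℝ) (i : Fin n) (w p : Fin n → ℝ) :
    agentLoss X a i w p = fun ω => ∑ j, w j * X j ω + (a i * p i - ∑ j, w j * p j) := by
  ext ω
  simp only [agentLoss, initialPosition, sub_mul, Finset.sum_sub_distrib, sum_single_mul]
  ring

theorem agentLoss_single {n : ℕ} (X : Fin n → Ω → ℝ) (a : Fin n → ℝ) (i k : Fin n) (l : ℝ)
    (p : Fin n → ℝ) :
    agentLoss X a i (Pi.single k l) p = fun ω => l * X k ω + (a i * p i - l * p k) := by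
  rw [agentLoss_eq]
  ext ω
  rw [sum_single_mul k l p, sum_single_mul k l (fun j => X j ω)]

theorem IsEquilibrium.sum_position {n : ℕ} {X : Fin n → Ω → ℝ} {a : Fin n → ℝ} {c : Fin n → ℝ → ℝ}
    {ρ : Fin n → (Ω → ℝ) → ℝ} {p : Fin n → ℝ} {w : Fin n → Fin n → ℝ}
    (h : IsEquilibrium X a c ρ p w) (j : Fin n) : ∑ i, w i j = a j := by
  have := congrFun h.clearance j
  simpa [initialPosition] using this

theorem IsEquilibrium.exists_position_pos {n : ℕ} {X : Fin n → Ω → ℝ} {a : Fin n → ℝ} (ha : ∀ i, 0 < a i)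
    {c : Fin n → ℝ → ℝ} {ρ : Fin n → (Ω → ℝ) → ℝ} {p : Fin n → ℝ} {w : Fin n → Fin n → ℝ}
    (h : IsEquilibrium X a c ρ p w) (j : Fin n) : ∃ i, 0 < w i j := by
  by_contra! hc
  have h1 := h.sum_position j
  have h2 : ∑ i, w i j ≤ 0 := Finset.sum_nonpos fun i _ => hc i
  linarith [ha j]

/-- Concentrating the total exposure of an optimal position on one loss does not reduce the
risk. -/
theorem IsEquilibrium.risk_le_single {n : ℕ} {X : Fin n → Ω → ℝ} {a : Fin n → ℝ} {c : Fin n → ℝ → ℝ}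
    {ρ : Fin n → (Ω → ℝ) → ℝ} {p : Fin n → ℝ} {w : Fin n → Fin n → ℝ}
    (h : IsEquilibrium X a c ρ p w) (i k : Fin n) :
    ρ i (fun ω => ∑ j, w i j * X j ω + (a i * p i - ∑ j, w i j * p j)) ≤
      ρ i (fun ω => (∑ j, w i j) * X k ω + (a i * p i - (∑ j, w i j) * p k)) := by
  have hW : 0 ≤ ∑ j, w i j := Finset.sum_nonneg fun j _ => h.position_nonneg i j
  have := h.optimal i (Pi.single k (∑ j, w i j)) (Pi.single_nonneg.2 hW)
  rw [agentObjective, agentObjective, agentLoss_single, agentLoss_eq, totalExposure_single k hW,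
    totalExposure_of_nonneg (h.position_nonneg i)] at this
  linarith

variable [MeasurableSpace Ω]

theorem IsLossDomain.mul_add_mem {μ : Measure Ω} {n : ℕ} {X : Fin n → Ω → ℝ} {L : Set (Ω → ℝ)}
    (hL : IsLossDomain μ X L) (k : Fin n) {l : ℝ} (hl : 0 ≤ l) (b : ℝ) :
    (fun ω => l * X k ω + b) ∈ L := by
  have h := hL.cone_mem (Pi.single k l) b (Pi.single_nonneg.2 hl)
  have e : (fun ω => ∑ j, (Pi.single k l : Fin n → ℝ) j * X j ω + b) =
      fun ω => l * X k ω + b := by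
    ext ω; rw [sum_single_mul k l (fun j => X j ω)]
  rwa [e] at h

theorem IsLossDomain.mem {μ : Measure Ω} {n : ℕ} {X : Fin n → Ω → ℝ} {L : Set (Ω → ℝ)}
    (hL : IsLossDomain μ X L) (k : Fin n) : X k ∈ L := by
  simpa using hL.mul_add_mem k zero_le_one 0

theorem stochLE_of_identDistrib {μ : Measure Ω} {Y Z : Ω → ℝ} (h : IdentDistrib Y Z μ μ) :
    StochLE μ Y Z := fun x => (h.measure_mem_eq (s := Ioi x) measurableSet_Ioi).le

theorem MildlyMonotoneOn.eq_of_identDistrib {μ : Measure Ω} {L : Set (Ω → ℝ)}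
    {ρ : (Ω → ℝ) → ℝ} (hρ : MildlyMonotoneOn μ L ρ) {Y Z : Ω → ℝ} (hY : Y ∈ L) (hZ : Z ∈ L)
    (h : IdentDistrib Y Z μ μ) : ρ Y = ρ Z :=
  le_antisymm (hρ.1 Y hY Z hZ (stochLE_of_identDistrib h))
    (hρ.1 Z hZ Y hY (stochLE_of_identDistrib h.symm))

/-! ### Optimal positions and equilibria -/

section Market

variable {μ : Measure Ω} [IsProbabilityMeasure μ] {n : ℕ} {X : Fin n → Ω → ℝ} {L : Set (Ω → ℝ)}
  {ρ : (Ω → ℝ) → ℝ}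

/-- A portfolio is at least as risky as a single loss with the same total exposure. -/
theorem MildlyMonotoneOn.risk_single_le (hρ : MildlyMonotoneOn μ L ρ)
    (hX : IsWNAIDSuperPareto μ X) (hL : IsLossDomain μ X L) {w : Fin n → ℝ} (hw : 0 ≤ w)
    (k : Fin n) (b : ℝ) :
    ρ (fun ω => (∑ j, w j) * X k ω + b) ≤ ρ (fun ω => ∑ j, w j * X j ω + b) := by
  refine hρ.1 _ (hL.mul_add_mem k (Finset.sum_nonneg fun j _ => hw j) b) _
    (hL.cone_mem w b hw) fun x => ?_
  have h := (hX.measureReal_sum_le hw k (x - b)).1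
  rw [measureReal_le_eq_one_sub (hX.measurable_sum w),
    measureReal_le_eq_one_sub ((hX.measurable k).const_mul _)] at h
  simp only [sub_lt_iff_lt_add] at h
  exact (ENNReal.toReal_le_toReal (measure_ne_top _ _) (measure_ne_top _ _)).1
    (show μ.real _ ≤ μ.real _ by linarith)

/-- For continuous laws, a portfolio with at least two positive positions is strictly riskier than
a single loss with the same total exposure. -/
theorem MildlyMonotoneOn.risk_single_lt (hρ : MildlyMonotoneOn μ L ρ)
    (hX : IsWNAIDSuperPareto μ X) (hL : IsLossDomain μ X L) {w : Fin n → ℝ} (hw : 0 ≤ w)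
    (h2 : ∃ i j, i ≠ j ∧ 0 < w i ∧ 0 < w j) (k : Fin n) (hk : ∀ x, μ {ω | X k ω = x} = 0)
    (b : ℝ) :
    ρ (fun ω => (∑ j, w j) * X k ω + b) < ρ (fun ω => ∑ j, w j * X j ω + b) := by
  have hWn : 0 ≤ ∑ j, w j := Finset.sum_nonneg fun j _ => hw j
  have hW : 0 < ∑ j, w j := by
    obtain ⟨i, -, -, hi, -⟩ := h2
    exact Finset.sum_pos' (fun j _ => hw j) ⟨i, Finset.mem_univ i, hi⟩
  have hatom : ∀ x, μ {ω | (∑ j, w j) * X k ω = x} = 0 := by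
    intro x
    rw [← hk (x / ∑ j, w j)]
    congr 1
    ext ω
    rw [mem_ofPred_eq, mem_ofPred_eq, eq_div_iff hW.ne', mul_comm]
  -- The portfolio itself need not exceed the single loss almost surely; a copy of it does, and it
  -- has the same risk.
  obtain ⟨Z, hZm, hZ, hlt⟩ := exists_identDistrib_ae_lt ((hX.measurable k).const_mul _)
    (hX.measurable_sum w) hatom fun t => (hX.measureReal_sum_le hw k t).2 h2
  have hZb : IdentDistrib (fun ω => Z ω + b) (fun ω => ∑ j, w j * X j ω + b) μ μ :=
    hZ.comp (measurable_id.add_const b)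
  have hmem := hL.cone_mem w b hw
  have hZL := hL.lawInvariant _ hmem _ (hZm.add_const b) hZb
  rw [← hρ.eq_of_identDistrib hZL hmem hZb]
  refine hρ.2 _ (hL.mul_add_mem k hWn b) _ hZL ?_
  filter_upwards [hlt] with ω hω
  linarith

/-- Agents only take positions in losses with the maximal premium. -/
theorem IsEquilibrium.price_eq_of_position_pos {a : Fin n → ℝ} {c : Fin n → ℝ → ℝ}
    {ρ : Fin n → (Ω → ℝ) → ℝ} {p : Fin n → ℝ} {w : Fin n → Fin n → ℝ}
    (h : IsEquilibrium X a c ρ p w) (hX : IsWNAIDSuperPareto μ X) (hL : IsLossDomain μ X L)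
    (hρ : ∀ i, MildlyMonotoneOn μ L (ρ i)) {k : Fin n} (hk : ∀ j, p j ≤ p k) {i j : Fin n}
    (hj : 0 < w i j) : p j = p k := by
  have hw := h.position_nonneg i
  have hW : 0 ≤ ∑ j, w i j := Finset.sum_nonneg fun j _ => hw j
  by_contra hne
  have hlt : ∑ j, w i j * p j < (∑ j, w i j) * p k := by
    rw [Finset.sum_mul]
    exact Finset.sum_lt_sum (fun l _ => mul_le_mul_of_nonneg_left (hk l) (hw l))
      ⟨j, Finset.mem_univ j, mul_lt_mul_of_pos_left (lt_of_le_of_ne (hk j) hne) hj⟩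
  -- Contradictory cycle: the held portfolio is at most as risky as the single loss `k` at its own
  -- premium; this is strictly less risky than that loss with the old, smaller premium income, which
  -- by dominance is at most as risky as the portfolio.
  have h1 := h.risk_le_single i k
  have h2 := (hρ i).risk_single_le hX hL hw k (a i * p i - ∑ j, w i j * p j)
  have h3 := (hρ i).2 _ (hL.mul_add_mem k hW (a i * p i - (∑ j, w i j) * p k)) _
    (hL.mul_add_mem k hW (a i * p i - ∑ j, w i j * p j)) (ae_of_all _ fun ω => by linarith)
  linarith

/-- All losses have the same equilibrium premium. -/
theorem IsEquilibrium.exists_price_eq_const {a : Fin n → ℝ} (ha : ∀ i, 0 < a i)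
    {c : Fin n → ℝ → ℝ} {ρ : Fin n → (Ω → ℝ) → ℝ} {p : Fin n → ℝ} {w : Fin n → Fin n → ℝ}
    (h : IsEquilibrium X a c ρ p w) (hX : IsWNAIDSuperPareto μ X) (hL : IsLossDomain μ X L)
    (hρ : ∀ i, MildlyMonotoneOn μ L (ρ i)) [Nonempty (Fin n)] :
    ∃ q : ℝ, 0 ≤ q ∧ p = fun _ => q := by
  obtain ⟨k, hk⟩ := Finite.exists_max p
  refine ⟨p k, h.price_nonneg k, funext fun j => ?_⟩
  obtain ⟨i, hi⟩ := h.exists_position_pos ha j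
  exact h.price_eq_of_position_pos hX hL hρ hk hi

/-- In equilibrium, no agent holds two different losses with continuous law. -/
theorem IsEquilibrium.position_unique {a : Fin n → ℝ} {c : Fin n → ℝ → ℝ}
    {ρ : Fin n → (Ω → ℝ) → ℝ} {q : ℝ} {w : Fin n → Fin n → ℝ}
    (h : IsEquilibrium X a c ρ (fun _ => q) w) (hX : IsWNAIDSuperPareto μ X)
    (hL : IsLossDomain μ X L) (hρ : ∀ i, MildlyMonotoneOn μ L (ρ i))
    (hatom : ∀ k x, μ {ω | X k ω = x} = 0) {i j j' : Fin n} (hj : 0 < w i j) (hj' : 0 < w i j') :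
    j = j' := by
  by_contra hne
  have h1 := h.risk_le_single i j
  -- With equal premiums the income depends only on the total exposure, so both comparisons carry
  -- the same constant.
  have h2 := (hρ i).risk_single_lt hX hL (h.position_nonneg i) ⟨j, j', hne, hj, hj'⟩ j (hatom j)
    (a i * q - (∑ j, w i j) * q)
  simp only [← Finset.sum_mul] at h1
  linarith

/-- Choose a holder `e j` of each loss `j`. Nobody holds two losses, so `e` is injective, hence
bijective; each loss then has a single holder, who by clearance takes all of `a j`. The permutation
is the inverse of `e`. -/
theorem IsEquilibrium.exists_perm {a : Fin n → ℝ} (ha : ∀ i, 0 < a i) {c : Fin n → ℝ → ℝ}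
    {ρ : Fin n → (Ω → ℝ) → ℝ} {q : ℝ} {w : Fin n → Fin n → ℝ}
    (h : IsEquilibrium X a c ρ (fun _ => q) w) (hX : IsWNAIDSuperPareto μ X)
    (hL : IsLossDomain μ X L) (hρ : ∀ i, MildlyMonotoneOn μ L (ρ i))
    (hatom : ∀ k x, μ {ω | X k ω = x} = 0) :
    ∃ σ : Equiv.Perm (Fin n), ∀ i, w i = initialPosition a (σ i) := by
  choose e he using h.exists_position_pos ha
  have hinj : Function.Injective e := fun j j' hjj' =>
    h.position_unique hX hL hρ hatom (he j) (hjj' ▸ he j')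
  set τ := Equiv.ofBijective e (Finite.injective_iff_bijective.1 hinj) with hτ
  have hzero : ∀ j j', j' ≠ j → w (e j) j' = 0 := fun j j' hne => by
    refine le_antisymm (not_lt.1 fun hpos => ?_) (h.position_nonneg (e j) j')
    exact hne (h.position_unique hX hL hρ hatom hpos (he j))
  refine ⟨τ.symm, fun i => ?_⟩
  obtain ⟨j, rfl⟩ := τ.surjective i
  rw [Equiv.symm_apply_apply]
  change w (e j) = _
  ext j'
  rcases eq_or_ne j' j with rfl | hne
  · rw [initialPosition, Pi.single_eq_same, ← h.sum_position j']
    symm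
    refine Finset.sum_eq_single (e j') (fun i _ hi => ?_)
      fun hj => absurd (Finset.mem_univ _) hj
    obtain ⟨l, rfl⟩ := τ.surjective i
    exact hzero l j' fun hl => hi (by rw [hl]; rfl)
  · rw [initialPosition, Pi.single_eq_of_ne hne, hzero j j' hne]

/-- The subgradients of a convex function lie between its left and right derivatives. -/
theorem subgradient_iff {c : ℝ → ℝ} (hc : ConvexOn ℝ univ c) (x q : ℝ) :
    (∀ y, c x + q * (y - x) ≤ c y) ↔ q ≤ rightDeriv c x ∧ leftDeriv c x ≤ q := by
  have hx : x ∈ interior (univ : Set ℝ) := by simp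
  constructor
  · intro h
    constructor
    · rw [rightDeriv, hc.rightDeriv_eq_sInf_slope_of_mem_interior hx]
      refine le_csInf ⟨_, x + 1, by simp, rfl⟩ ?_
      rintro _ ⟨y, hy, rfl⟩
      rw [slope_def_field, le_div_iff₀ (sub_pos.2 hy.2)]
      linarith [h y]
    · rw [leftDeriv, hc.leftDeriv_eq_sSup_slope_of_mem_interior hx]
      refine csSup_le ⟨_, x - 1, by simp, rfl⟩ ?_
      rintro _ ⟨y, hy, rfl⟩
      rw [slope_comm, slope_def_field, div_le_iff₀ (sub_pos.2 hy.2)]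
      linarith [h y]
  · rintro ⟨h1, h2⟩ y
    rcases lt_trichotomy y x with hyx | rfl | hxy
    · have := (hc.slope_le_leftDeriv_of_mem_interior (mem_univ y) hx hyx).trans h2
      rw [slope_def_field, div_le_iff₀ (sub_pos.2 hyx)] at this
      linarith
    · simp
    · have := h1.trans (hc.rightDeriv_le_slope_of_mem_interior hx (mem_univ y) hxy)
      rw [slope_def_field, le_div_iff₀ (sub_pos.2 hxy)] at this
      linarith

/-- The objective of an agent with a distortion risk measure who concentrates the exposure on a
single loss. -/
theorem agentObjective_single {a : Fin n → ℝ} (ha : ∀ i, 0 < a i) {c : Fin n → ℝ → ℝ}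
    {ρ : Fin n → (Ω → ℝ) → ℝ} (hL : IsLossDomain μ X L) {i : Fin n}
    (hd : IsDistortionOn μ L (ρ i)) (k : Fin n) {l : ℝ} (hl : 0 ≤ l) (p : ℝ) :
    agentObjective X a c ρ (fun _ => p) i (Pi.single k l) =
      a i * p - l * (p - ρ i (X k)) + c i (l - a i) := by
  rw [agentObjective, agentLoss_single, totalExposure_single k hl, initialPosition,
    totalExposure_single i (ha i).le, hd.apply_mul_add (hL.mem k) hl (hL.mul_add_mem k hl _)]
  ring

/-- By dominance it suffices to compete with multiples of the agent's own loss. Along these the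
objective is a convex function of the exposure, and the hypothesis says that `p - ρ i (X i)` is a
subgradient of the cost at `0`. -/
theorem isEquilibrium_initialPosition {a : Fin n → ℝ} (ha : ∀ i, 0 < a i) {c : Fin n → ℝ → ℝ}
    (hc : ∀ i, IsCostFunction (c i)) {ρ : Fin n → (Ω → ℝ) → ℝ} (hX : IsWNAIDSuperPareto μ X)
    (hL : IsLossDomain μ X L) (hρ : ∀ i, MildlyMonotoneOn μ L (ρ i))
    (hd : ∀ i, IsDistortionOn μ L (ρ i)) {p : ℝ} (hp : 0 ≤ p)
    (h : ∀ i, p - ρ i (X i) ≤ rightDeriv (c i) 0 ∧ leftDeriv (c i) 0 ≤ p - ρ i (X i)) :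
    IsEquilibrium X a c ρ (fun _ => p) (initialPosition a) where
  price_nonneg := fun _ => hp
  position_nonneg := fun i => Pi.single_nonneg.2 (ha i).le
  clearance := rfl
  optimal := by
    intro i v hv
    have hW : 0 ≤ ∑ j, v j := Finset.sum_nonneg fun j _ => hv j
    have h1 : agentObjective X a c ρ (fun _ => p) i (Pi.single i (∑ j, v j)) ≤
        agentObjective X a c ρ (fun _ => p) i v := by
      rw [agentObjective, agentObjective, agentLoss_single, agentLoss_eq,
        totalExposure_single i hW, totalExposure_of_nonneg hv, ← Finset.sum_mul]
      have := (hρ i).risk_single_le hX hL hv i (a i * p - (∑ j, v j) * p)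
      linarith
    refine le_trans ?_ h1
    rw [initialPosition, agentObjective_single ha hL (hd i) i (ha i).le,
      agentObjective_single ha hL (hd i) i hW, sub_self, (hc i).zero]
    have := (subgradient_iff (hc i).convex 0 _).2 (h i) (∑ j, v j - a i)
    rw [(hc i).zero] at this
    linarith

/-- First-order condition for an agent who optimally holds a single loss. -/
theorem IsEquilibrium.subgradient {a : Fin n → ℝ} (ha : ∀ i, 0 < a i) {c : Fin n → ℝ → ℝ}
    (hc : ∀ i, IsCostFunction (c i)) {ρ : Fin n → (Ω → ℝ) → ℝ} (hL : IsLossDomain μ X L)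
    {p : ℝ} {w : Fin n → Fin n → ℝ} (h : IsEquilibrium X a c ρ (fun _ => p) w) {i k : Fin n}
    (hd : IsDistortionOn μ L (ρ i)) (hk : w i = initialPosition a k) :
    p - ρ i (X k) ≤ rightDeriv (c i) (a k - a i) ∧
      leftDeriv (c i) (a k - a i) ≤ p - ρ i (X k) := by
  set q := p - ρ i (X k) with hq
  rw [← subgradient_iff (hc i).convex]
  have hopt : ∀ l, 0 ≤ l → c i (a k - a i) - a k * q ≤ c i (l - a i) - l * q := by
    intro l hl
    have := h.optimal i (Pi.single k l) (Pi.single_nonneg.2 hl)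
    rw [hk, initialPosition, agentObjective_single ha hL hd k (ha k).le,
      agentObjective_single ha hL hd k hl] at this
    linarith
  have hconv : ConvexOn ℝ univ fun y => c i y - q * y := by
    have hlin : ConcaveOn ℝ univ fun y : ℝ => q * y :=
      (LinearMap.mulLeft ℝ q).concaveOn convex_univ
    exact (hc i).convex.sub hlin
  -- Optimality is known only for exposures `y + a i ≥ 0`. Since `a k > 0`, the point is interior to
  -- this range, and convexity makes the local minimum global.
  have hloc : IsLocalMin (fun y => c i y - q * y) (a k - a i) := by
    filter_upwards [lt_mem_nhds (show -a i < a k - a i by linarith [ha k])] with y hy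
    have := hopt (y + a i) (by linarith)
    rw [add_sub_cancel_right] at this
    linarith
  intro y
  have := IsMinOn.of_isLocalMin_of_convex_univ hloc hconv y
  linarith

end Market

end

end RiskSharing

end

/-! ### Assembly of the three assertions -/

theorem mainTheorem1 {Ω : Type*} [MeasurableSpace Ω] (μ : Measure Ω) [IsProbabilityMeasure μ]
    (n : ℕ) (hn : 2 ≤ n)
    (X : Fin n → Ω → ℝ) (hX : RiskSharing.IsWNAIDSuperPareto μ X)
    (X₀ : Ω → ℝ) (hX₀ : Measurable X₀) (hX₀X : ∀ i, IdentDistrib X₀ (X i) μ μ)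
    (L : Set (Ω → ℝ)) (hL : RiskSharing.IsLossDomain μ X L)
    (a : Fin n → ℝ) (ha : ∀ i, 0 < a i)
    (c : Fin n → ℝ → ℝ) (hc : ∀ i, RiskSharing.IsCostFunction (c i))
    (ρ : Fin n → (Ω → ℝ) → ℝ) (hρ : ∀ i, RiskSharing.MildlyMonotoneOn μ L (ρ i)) :
    ((∀ x : ℝ, μ {ω | X₀ ω = x} = 0) →
      ∀ (p : Fin n → ℝ) (w : Fin n → Fin n → ℝ), RiskSharing.IsEquilibrium X a c ρ p w →
        (∃ q : ℝ, 0 ≤ q ∧ p = fun _ => q) ∧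
        ∃ σ : Equiv.Perm (Fin n), ∀ i, w i = RiskSharing.initialPosition a (σ i)) ∧
    ((∀ i, RiskSharing.IsDistortionOn μ L (ρ i)) →
      ∀ p : ℝ, 0 ≤ p →
        (∀ i, p - ρ i X₀ ≤ RiskSharing.rightDeriv (c i) 0 ∧
          RiskSharing.leftDeriv (c i) 0 ≤ p - ρ i X₀) →
        RiskSharing.IsEquilibrium X a c ρ (fun _ => p) (RiskSharing.initialPosition a)) ∧
    ((∀ x : ℝ, μ {ω | X₀ ω = x} = 0) →
      (∀ i, RiskSharing.IsDistortionOn μ L (ρ i)) →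
      ∀ p : ℝ, (∃ w : Fin n → Fin n → ℝ, RiskSharing.IsEquilibrium X a c ρ (fun _ => p) w) →
        ∀ i, p - ρ i X₀ ≤ (⨆ j, RiskSharing.rightDeriv (c i) (a j - a i)) ∧
          (⨅ j, RiskSharing.leftDeriv (c i) (a j - a i)) ≤ p - ρ i X₀) := by
  have : Nonempty (Fin n) := ⟨⟨0, by omega⟩⟩
  have hX₀L : X₀ ∈ L :=
    hL.lawInvariant _ (hL.mem (Classical.arbitrary _)) X₀ hX₀ (hX₀X _)
  have hρX : ∀ i k, ρ i (X k) = ρ i X₀ := fun i k =>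
    ((hρ i).eq_of_identDistrib hX₀L (hL.mem k) (hX₀X k)).symm
  have hatom : (∀ x : ℝ, μ {ω | X₀ ω = x} = 0) → ∀ k x, μ {ω | X k ω = x} = 0 :=
    fun h k x => ((hX₀X k).measure_mem_eq (measurableSet_singleton x)).symm.trans (h x)
  refine ⟨fun h0 p w hw => ?_, fun hd p hp h => ?_, fun h0 hd p hw i => ?_⟩
  · obtain ⟨q, hq, rfl⟩ := hw.exists_price_eq_const ha hX hL hρ
    exact ⟨⟨q, hq, rfl⟩, hw.exists_perm ha hX hL hρ (hatom h0)⟩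
  · exact RiskSharing.isEquilibrium_initialPosition ha hc hX hL hρ hd hp fun i => by
      rw [hρX]; exact h i
  · obtain ⟨w, hw⟩ := hw
    obtain ⟨σ, hσ⟩ := hw.exists_perm ha hX hL hρ (hatom h0)
    -- The first-order condition holds at the unknown index `σ i`; the maximum and minimum over all
    -- indices remove this dependence.
    have h := hw.subgradient ha hc hL (hd i) (hσ i)
    rw [hρX] at h
    exact ⟨h.1.trans (le_ciSup (f := fun j => RiskSharing.rightDeriv (c i) (a j - a i))
        (Set.finite_range _).bddAbove (σ i)),
      (ciInf_le (f := fun j => RiskSharing.leftDeriv (c i) (a j - a i))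
        (Set.finite_range _).bddBelow (σ i)).trans h.2⟩
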